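/- A sequence over a finite group $G$ is a finite tuple of elements of $G$ (repetition allowed); a subsequence is obtained by keeping the terms at a nonempty set of indices. A product-one sequence is a nonempty sequence whose terms, multiplied in some order, have product $1$. Let $d(G)$ be the least positive integer $m$ such that every sequence of length $m$ over $G$ contains a product-one subsequence. Let $f(G)$ be the least positive integer $m$ such that every sequence of length $d(G)$ over $G$ contains a product-one subsequence of length at most $m$. Let $e(G)$ be the least positive integer $m$ such that every product-one sequence over $G$ contains a product-one subsequence of length at most $m$. Let $\mathrm{Hol}(\mathbb{Z}_p)=\mathrm{Aut}(\mathbb{Z}_p)\ltimes\mathbb{Z}_p$ be the holomorph of the cyclic group of order $p$. **Theorem.** Let $p>5$ be a prime. Then $\mathrm{Hol}(\mathbb{Z}_p)\cong\mathbb{Z}_{p-1}\ltimes\mathbb{Z}_p$ for some faithful action of $\mathbb{Z}_{p-1}$ on $\mathbb{Z}_p$ by automorphisms, and $$e(\mathrm{Hol}(\mathbb{Z}_p))\le p+\frac{p-3}{2},\qquad f(\mathrm{Hol}(\mathbb{Z}_p))\le p+\frac{p-3}{2}.$$ -/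

import Mathlib

/-! Finite sequences of elements of a group are lists; a subsequence is a nonempty sublist
(a nonempty subset of the indices, taken in increasing order). -/

/-- A product-one sequence: a nonempty sequence whose terms, multiplied in some order, give `1`. -/
def IsProductOneSeq {G : Type*} [Group G] (S : List G) : Prop :=
  S ≠ [] ∧ ∃ L : List G, L.Perm S ∧ L.prod = 1

/-- The numbers `m ≥ 1` such that every sequence of length `m` in `G` contains a product-one
subsequence. -/
def davenportSet (G : Type*) [Group G] : Set ℕ :=
  {m | 0 < m ∧ ∀ S : List G, S.length = m → ∃ T : List G, T.Sublist S ∧ IsProductOneSeq T}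

/-- The Davenport constant `d(G)`: the least element of `davenportSet G`. -/
noncomputable def davenportConst (G : Type*) [Group G] : ℕ :=
  sInf (davenportSet G)

/-- The numbers `m ≥ 1` such that every sequence of length `d(G)` in `G` contains a product-one
subsequence of length at most `m`. -/
def fSet (G : Type*) [Group G] : Set ℕ :=
  {m | 0 < m ∧ ∀ S : List G, S.length = davenportConst G →
    ∃ T : List G, T.Sublist S ∧ IsProductOneSeq T ∧ T.length ≤ m}

/-- The constant `f(G)`: the least element of `fSet G`. -/
noncomputable def fConst (G : Type*) [Group G] : ℕ :=
  sInf (fSet G)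

/-- The numbers `m ≥ 1` such that every product-one sequence in `G` contains a product-one
subsequence of length at most `m`. -/
def eSet (G : Type*) [Group G] : Set ℕ :=
  {m | 0 < m ∧ ∀ S : List G, IsProductOneSeq S →
    ∃ T : List G, T.Sublist S ∧ IsProductOneSeq T ∧ T.length ≤ m}

/-- The constant `e(G)`: the least element of `eSet G`. -/
noncomputable def eConst (G : Type*) [Group G] : ℕ :=
  sInf (eSet G)

/-- In a finite group every sequence of length `|G|` has a product-one subsequence, so the
infimum defining `d(G)` is attained. -/
theorem card_mem_davenportSet (G : Type*) [Group G] [Finite G] :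
    Nat.card G ∈ davenportSet G := by
  refine ⟨Nat.card_pos, fun S hS => ?_⟩
  have := Fintype.ofFinite G
  obtain ⟨i, j, hij, h⟩ : ∃ i j : Fin (S.length + 1), i < j ∧
      (S.take i).prod = (S.take j).prod := by
    obtain ⟨i, j, hne, h⟩ := Fintype.exists_ne_map_eq_of_card_lt
      (fun i : Fin (S.length + 1) => (S.take i).prod)
      (by simp [hS, Nat.card_eq_fintype_card])
    rcases lt_or_gt_of_ne hne with hlt | hlt
    · exact ⟨i, j, hlt, h⟩
    · exact ⟨j, i, hlt, h.symm⟩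
  have hij' : (i : ℕ) < j := hij
  have hj : (j : ℕ) ≤ S.length := Nat.lt_succ_iff.mp j.2
  refine ⟨(S.take j).drop i, (List.drop_sublist _ _).trans (List.take_sublist _ _), ?_, _,
    List.Perm.refl _, ?_⟩
  · intro h0
    have := congrArg List.length h0
    simp at this
    omega
  · have h1 := List.prod_take_mul_prod_drop (S.take j) i
    rw [List.take_take, min_eq_left hij'.le, h] at h1
    exact mul_eq_left.mp h1

theorem davenportConst_isLeast (G : Type*) [Group G] [Finite G] :
    IsLeast (davenportSet G) (davenportConst G) :=
  ⟨Nat.sInf_mem ⟨_, card_mem_davenportSet G⟩, fun _ h => Nat.sInf_le h⟩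

theorem fConst_isLeast (G : Type*) [Group G] [Finite G] : IsLeast (fSet G) (fConst G) := by
  refine ⟨Nat.sInf_mem ⟨davenportConst G, (davenportConst_isLeast G).1.1, fun S hS => ?_⟩,
    fun _ h => Nat.sInf_le h⟩
  obtain ⟨T, hT, hT1⟩ := (davenportConst_isLeast G).1.2 S hS
  exact ⟨T, hT, hT1, hS ▸ hT.length_le⟩

theorem eConst_isLeast (G : Type*) [Group G] [Finite G] : IsLeast (eSet G) (eConst G) := by
  refine ⟨Nat.sInf_mem ⟨davenportConst G, (davenportConst_isLeast G).1.1, fun S hS => ?_⟩,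
    fun _ h => Nat.sInf_le h⟩
  rcases le_total S.length (davenportConst G) with hle | hle
  · exact ⟨S, List.Sublist.refl S, hS, hle⟩
  · have hlen : (S.take (davenportConst G)).length = davenportConst G := by simp [hle]
    obtain ⟨T, hT, hT1⟩ := (davenportConst_isLeast G).1.2 _ hlen
    exact ⟨T, hT.trans (List.take_sublist _ _), hT1, hlen ▸ hT.length_le⟩

/-- The holomorph of a group: the semidirect product `N ⋊ Aut(N)` for the tautological action. -/
abbrev Hol (N : Type*) [Group N] : Type _ :=
  N ⋊[MonoidHom.id (MulAut N)] MulAut N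

instance Hol.instFinite (N : Type*) [Group N] [Finite N] : Finite (Hol N) :=
  Finite.of_equiv _ SemidirectProduct.equivProd.symm

/-!
Write `p = 2k + 1`, so that the bound is `3k`. As every sequence of length `d(G)` contains a
product-one sequence, `f(G) ≤ e(G)` (`eSet_subset_fSet`), and it remains to find a product-one
subsequence of length at most `3k` in a product-one sequence `S` of length more than `3k`. The
holomorph consists of the affine maps `x ↦ a * x + b` of `ZMod p`. The linear parts `a` of `S` form
a multiset of product `1` in the cyclic group of order `2k`.

Suppose that some subsequence `W` with `p ≤ |W| ≤ 3k` has linear parts of product `1`. If `W` is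
minimal with this property, then the cyclic rotations of an ordering of `W` have `|W|` distinct
products, all of them translations. In general `W` splits into minimal blocks, and Scherk's
inequality `|A| + |B| ≤ |A + B| + 1` (`Finset.scherk_add`) shows that, without product-one
subsequences, `W` yields at least `|W|` nonzero translations. As there are only `p - 1` of them, `W`
contains a product-one subsequence (`AffineCoords.exists_prod_one_of_card_le`).

If there is no such `W`, then some generator `g` of the cyclic group is the linear part of at least
`p + 1` terms (`exists_generator_count_or_prod_one`). Indeed, unions of minimal blocks must jump
over the interval `[2k + 1, 3k]`, so two blocks have total length more than `3k`. Scherk's inequality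
in the cyclic group shows that the longer block consists mostly of copies of one generator `g`
(`IsProdFree.exists_count`), and an argument with the logarithms to base `g` does the rest
(`exists_sum_dvd_or_count_one`).

Finally, among `p + 1` terms with the same linear part `g`, some `p - 1` have product `1` in some
order (`AffineCoords.exists_prod_one_of_count`). The product of `p - 1` such terms is the
translation by `∑ g ^ i * b i`, whose coefficients run through the nonzero elements of `ZMod p`. So
the translation parts have to be placed at the nonzero elements `s` with `∑ s * c s = 0`
(`zero_mem_slotValues`). If one translation part is frequent, it may be taken to be `0`, and it is
enough to place a few others. Otherwise there are about `log₂ p` disjoint pairs of distinct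
translation parts, and their exchanges at suitable places change the sum by `1, 2, 4, …`, which
realises every value. The hypothesis `5 < p` provides the room for these places.
-/

/-! ### Scherk's inequality and disjoint pairs -/

open scoped Pointwise in
/-- Scherk's inequality: if the only factorisation `1 = x * y` with `x ∈ s`, `y ∈ t` is the
trivial one, then `|s| + |t| ≤ |s * t| + 1`. The Dyson transform at a point of `s` preserves the
hypothesis, and some such transform shrinks `t` unless `t = {1}`. -/
@[to_additive]
theorem Finset.scherk_mul {A : Type*} [CommGroup A] [DecidableEq A]
    (s t : Finset A) (hs : (1 : A) ∈ s) (ht : (1 : A) ∈ t)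
    (h : ∀ x ∈ s, ∀ y ∈ t, x * y = 1 → x = 1) :
    s.card + t.card ≤ (s * t).card + 1 := by
  induction hn : t.card using Nat.strong_induction_on generalizing s t with
  | _ n ih =>
  by_cases hstab : ∀ e ∈ s, t ⊆ e⁻¹ • s
  · have hst : ∀ x ∈ s, ∀ y ∈ t, x * y ∈ s := by
      intro x hx y hy
      have := hstab x hx hy
      rwa [Finset.mem_inv_smul_finset_iff, smul_eq_mul] at this
    have ht1 : t ⊆ {1} := by
      intro y hy
      rw [Finset.mem_singleton]
      have hpow : ∀ k : ℕ, y ^ k ∈ s := by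
        intro k
        induction k with
        | zero => simpa using hs
        | succ k ihk => rw [pow_succ]; exact hst _ ihk _ hy
      -- `s` is finite, so `y` has finite order and `y⁻¹` is one of its powers in `s`
      have hfin : ¬ Function.Injective fun k : ℕ => (⟨y ^ k, hpow k⟩ : s) :=
        not_injective_infinite_finite _
      have hy' : IsOfFinOrder y := by
        by_contra hinj
        rw [← injective_pow_iff_not_isOfFinOrder] at hinj
        exact hfin fun i j hij => hinj (by simpa using hij)
      have hpos := hy'.orderOf_pos
      have h1 : y ^ (orderOf y - 1) = 1 := by
        refine h _ (hpow _) y hy ?_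
        rw [← pow_succ, Nat.sub_add_cancel hpos, pow_orderOf_eq_one]
      have h2 := pow_orderOf_eq_one y
      rw [← Nat.sub_add_cancel hpos, pow_succ, h1, one_mul] at h2
      exact h2
    have hts := Finset.card_le_card ht1
    have hle : s.card ≤ (s * t).card := Finset.card_le_card_mul_right ⟨1, ht⟩
    rw [Finset.card_singleton] at hts
    omega
  · push Not at hstab
    obtain ⟨e, he, hsub⟩ := hstab
    have hcard := Finset.mulDysonETransform.card e (s, t)
    have hss := Finset.card_le_card (Finset.mulDysonETransform.subset e (s, t))
    simp only [Finset.mulDysonETransform_fst, Finset.mulDysonETransform_snd] at hcard hss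
    have hlt : (t ∩ e⁻¹ • s).card < n := by
      rw [← hn]
      refine Finset.card_lt_card ⟨Finset.inter_subset_left, fun hle => hsub ?_⟩
      exact hle.trans Finset.inter_subset_right
    have := ih _ hlt (s ∪ e • t) (t ∩ e⁻¹ • s) (Finset.mem_union_left _ hs)
      (by simp [ht, Finset.mem_inv_smul_finset_iff, he]) (by
        intro x hx y hy hxy
        rw [Finset.mem_inter, Finset.mem_inv_smul_finset_iff, smul_eq_mul] at hy
        rcases Finset.mem_union.1 hx with hx | hx
        · exact h x hx y hy.1 hxy
        · obtain ⟨z, hz, rfl⟩ := Finset.mem_smul_finset.1 hx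
          rw [smul_eq_mul] at hxy ⊢
          have h1 : e * y = 1 := h _ hy.2 z hz (by rw [mul_right_comm]; exact hxy)
          have h2 : z = 1 := by rwa [mul_right_comm, h1, one_mul] at hxy
          rw [h2, mul_one]
          exact h e he y hy.1 h1) rfl
    omega

theorem Multiset.exists_le_map_eq_of_le_map {α β : Type*} {f : α → β} {s : Multiset α}
    {t : Multiset β} (h : t ≤ s.map f) : ∃ u ≤ s, u.map f = t := by
  induction s using Quotient.inductionOn with
  | _ l =>
  induction t using Quotient.inductionOn with
  | _ m =>
  obtain ⟨l', hl', hsub⟩ := h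
  obtain ⟨l'', hl'', rfl⟩ := List.sublist_map_iff.1 hsub
  exact ⟨l'', hl''.subperm, Quot.sound hl'⟩

/-- The multiset of the entries of a list of pairs. -/
def pairSum {α : Type*} (l : List (α × α)) : Multiset α :=
  (l.map fun x => ({x.1, x.2} : Multiset α)).sum

@[simp]
theorem pairSum_nil {α : Type*} : pairSum ([] : List (α × α)) = 0 := rfl

@[simp]
theorem pairSum_cons {α : Type*} (x : α × α) (l : List (α × α)) :
    pairSum (x :: l) = {x.1, x.2} + pairSum l := by
  simp [pairSum]

theorem card_pairSum {α : Type*} (l : List (α × α)) :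
    Multiset.card (pairSum l) = 2 * l.length := by
  induction l with
  | nil => simp
  | cons x l ih => simp [ih]; omega

/-- A multiset in which no element is too frequent contains `q` disjoint pairs of distinct
elements: remove the two most frequent elements repeatedly. -/
theorem Multiset.exists_pairs {α : Type*} [DecidableEq α] (q : ℕ) (s : Multiset α)
    (hq : 2 * q ≤ card s) (hs : ∀ x, s.count x + q ≤ card s) :
    ∃ l : List (α × α), l.length = q ∧ (∀ x ∈ l, x.1 ≠ x.2) ∧ pairSum l ≤ s := by
  induction q generalizing s with
  | zero => exact ⟨[], rfl, by simp, by simp⟩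
  | succ q ih =>
    have hne : s.toFinset.Nonempty := by
      rw [Multiset.toFinset_nonempty]
      rintro rfl
      simp at hq
    obtain ⟨x, hx, hxmax⟩ := Finset.exists_max_image s.toFinset (fun x => s.count x) hne
    rw [Multiset.mem_toFinset] at hx
    have hne' : (s.toFinset.erase x).Nonempty := by
      rw [Finset.nonempty_iff_ne_empty]
      intro h0
      have hall : ∀ y ∈ s, x = y := by
        intro y hy
        by_contra hyx
        have : y ∈ s.toFinset.erase x := by simp [hy, Ne.symm hyx]
        simp [h0] at this
      have := Multiset.count_eq_card.2 hall
      have := hs x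
      omega
    obtain ⟨y, hy, hymax⟩ := Finset.exists_max_image _ (fun x => s.count x) hne'
    rw [Finset.mem_erase, Multiset.mem_toFinset] at hy
    have hle : ({x, y} : Multiset α) ≤ s := by
      rw [Multiset.le_iff_count]
      intro z
      have hx1 := Multiset.one_le_count_iff_mem.2 hx
      have hy1 := Multiset.one_le_count_iff_mem.2 hy.2
      simp only [Multiset.insert_eq_cons, Multiset.count_cons, Multiset.count_singleton]
      split_ifs with h1 h2 h2
      · exact absurd (h1.symm.trans h2) hy.1
      · simpa [h1] using hy1
      · simpa [h2] using hx1
      · simp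
    obtain ⟨t, rfl⟩ := Multiset.le_iff_exists_add.1 hle
    have hcard : card ({x, y} + t) = card t + 2 := by
      rw [Multiset.card_add, Multiset.card_pair, add_comm]
    have hcount : ∀ z, ({x, y} + t).count z
        = t.count z + ((if z = x then 1 else 0) + if z = y then 1 else 0) := by
      intro z
      simp only [Multiset.insert_eq_cons, Multiset.count_add, Multiset.count_cons,
        Multiset.count_singleton]
      omega
    obtain ⟨l, hl, hlne, hlt⟩ := ih t (by omega) (by
      intro z
      by_contra hz
      have hsz := hs z
      have hcz := hcount z
      by_cases hzx : z = x
      · rw [if_pos hzx] at hcz; omega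
      by_cases hzy : z = y
      · rw [if_neg hzx, if_pos hzy] at hcz; omega
      rw [if_neg hzx, if_neg hzy] at hcz
      have hzmem : z ∈ {x, y} + t := by
        rw [← Multiset.one_le_count_iff_mem]; omega
      have h1 := hymax z (by rw [Finset.mem_erase, Multiset.mem_toFinset]; exact ⟨hzx, hzmem⟩)
      have h2 := hxmax z (by rwa [Multiset.mem_toFinset])
      have h3 := hcount x
      have h4 := hcount y
      rw [if_pos rfl, if_neg hy.1.symm] at h3
      rw [if_pos rfl, if_neg hy.1] at h4
      -- three elements of multiplicity more than a third of the cardinality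
      have h5 : ({x, y, z} : Finset α).sum (fun v => t.count v) ≤ card t := by
        rw [← Multiset.sum_count_eq_card (s := ({x, y, z} : Finset α) ∪ t.toFinset)
          (fun a ha => by simp [ha])]
        exact Finset.sum_le_sum_of_subset Finset.subset_union_left
      rw [Finset.sum_insert (by simp [hy.1.symm, Ne.symm hzx]),
        Finset.sum_insert (by simp [Ne.symm hzy]), Finset.sum_singleton] at h5
      omega)
    refine ⟨(x, y) :: l, by simp [hl], ?_, ?_⟩
    · intro w hw
      rcases List.mem_cons.1 hw with rfl | hw
      · exact hy.1.symm
      · exact hlne w hw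
    · rw [pairSum_cons]
      exact add_le_add_right hlt _

/-! ### Product-free multisets in abelian groups -/

section SubsequenceProducts

variable {A : Type*} [CommGroup A]

/-- A multiset without nonempty sub-multisets of product `1`. -/
def IsProdFree (T : Multiset A) : Prop :=
  ∀ U ≤ T, U.prod = 1 → U = 0

theorem IsProdFree.mono {T U : Multiset A} (hT : IsProdFree T) (h : U ≤ T) : IsProdFree U :=
  fun V hV => hT V (hV.trans h)

variable [DecidableEq A]

/-- The products of the sub-multisets of `T`, including the empty one. -/
def subProds (T : Multiset A) : Finset A :=
  (T.powerset.map Multiset.prod).toFinset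

theorem mem_subProds {T : Multiset A} {x : A} : x ∈ subProds T ↔ ∃ U ≤ T, U.prod = x := by
  simp [subProds]

theorem one_mem_subProds (T : Multiset A) : (1 : A) ∈ subProds T :=
  mem_subProds.2 ⟨0, by simp, by simp⟩

open scoped Pointwise in
theorem card_subProds_add_le {T U : Multiset A} (h : IsProdFree (T + U)) :
    (subProds T).card + (subProds U).card ≤ (subProds (T + U)).card + 1 := by
  refine (Finset.scherk_mul _ _ (one_mem_subProds T) (one_mem_subProds U)
    ?_).trans (Nat.add_le_add_right (Finset.card_le_card ?_) 1)
  · intro x hx y hy hxy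
    obtain ⟨V, hV, rfl⟩ := mem_subProds.1 hx
    obtain ⟨W, hW, rfl⟩ := mem_subProds.1 hy
    have := h (V + W) (add_le_add hV hW) (by rw [Multiset.prod_add, hxy])
    rw [add_eq_zero] at this
    simp [this.1]
  · intro z hz
    obtain ⟨x, hx, y, hy, rfl⟩ := Finset.mem_mul.1 hz
    obtain ⟨V, hV, rfl⟩ := mem_subProds.1 hx
    obtain ⟨W, hW, rfl⟩ := mem_subProds.1 hy
    exact mem_subProds.2 ⟨V + W, add_le_add hV hW, Multiset.prod_add _ _⟩

theorem card_succ_le_card_subProds (T : Multiset A) (hT : IsProdFree T) :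
    Multiset.card T + 1 ≤ (subProds T).card := by
  induction T using Multiset.induction with
  | empty => exact Finset.card_pos.2 ⟨1, one_mem_subProds 0⟩
  | cons x T ih =>
    have h1 := ih (hT.mono (Multiset.le_cons_self T x))
    have h2 : 1 < (subProds {x}).card := by
      rw [Finset.one_lt_card]
      refine ⟨1, one_mem_subProds _, x, mem_subProds.2 ⟨{x}, le_rfl, by simp⟩, fun hx => ?_⟩
      have := hT {x} (by simp) (by simp [← hx])
      simp at this
    have h3 := card_subProds_add_le (T := {x}) (U := T) (by simpa using hT)
    rw [Multiset.singleton_add] at h3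
    rw [Multiset.card_cons]
    omega

theorem four_le_card_subProds {x y : A} (hxy : x ≠ y) (h : IsProdFree {x, y}) :
    4 ≤ (subProds {x, y}).card := by
  have hx : x ≠ 1 := by
    rintro rfl
    have := h {1} (by simp) (by simp)
    simp at this
  have hy : y ≠ 1 := by
    rintro rfl
    have := h {1} (by simp) (by simp)
    simp at this
  have hm : x * y ≠ 1 := by
    intro hm
    have := h {x, y} le_rfl (by simpa using hm)
    simp at this
  have hsub : ({1, x, y, x * y} : Finset A) ⊆ subProds {x, y} := by
    intro z hz
    simp only [Finset.mem_insert, Finset.mem_singleton] at hz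
    rw [mem_subProds]
    rcases hz with rfl | rfl | rfl | rfl
    · exact ⟨0, by simp, by simp⟩
    · exact ⟨{z}, by simp, by simp⟩
    · exact ⟨{z}, by simp, by simp⟩
    · exact ⟨{x, y}, le_rfl, by simp⟩
  refine le_trans (Eq.ge ?_) (Finset.card_le_card hsub)
  rw [Finset.card_insert_of_notMem (by simp [hx.symm, hy.symm, hm.symm]),
    Finset.card_insert_of_notMem (by simp [hxy, hy]),
    Finset.card_insert_of_notMem (by simp [hx]), Finset.card_singleton]

theorem card_pairSum_le_card_subProds (l : List (A × A)) (hl : ∀ x ∈ l, x.1 ≠ x.2)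
    (h : IsProdFree (pairSum l)) : 3 * l.length + 1 ≤ (subProds (pairSum l)).card := by
  induction l with
  | nil => exact Finset.card_pos.2 ⟨1, one_mem_subProds _⟩
  | cons x l ih =>
    rw [pairSum_cons] at h ⊢
    have h1 := ih (fun y hy => hl y (List.mem_cons_of_mem _ hy))
      (h.mono (Multiset.le_add_left _ _))
    have h2 := four_le_card_subProds (hl x List.mem_cons_self) (h.mono (Multiset.le_add_right _ _))
    have h3 := card_subProds_add_le h
    rw [List.length_cons]
    omega

theorem IsProdFree.card_lt [Finite A] {T : Multiset A} (hT : IsProdFree T) :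
    Multiset.card T < Nat.card A := by
  have := Fintype.ofFinite A
  have h1 := card_succ_le_card_subProds T hT
  have h2 := Finset.card_le_univ (subProds T)
  rw [Nat.card_eq_fintype_card]
  omega

/-- A long product-free multiset has a very frequent element. Otherwise it contains more than
`|A| - 1 - |T|` disjoint pairs of distinct elements, and since such a pair has three nontrivial
sub-products, Scherk's inequality yields too many sub-products. -/
theorem IsProdFree.exists_count [Finite A] {T : Multiset A} (hT : IsProdFree T)
    (hcard : 2 * Nat.card A ≤ 3 * Multiset.card T) :
    ∃ g, 2 * Multiset.card T < T.count g + Nat.card A := by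
  have := Fintype.ofFinite A
  by_contra! hcon
  have hlt := hT.card_lt
  obtain ⟨l, hl, hne, hle⟩ := T.exists_pairs (Nat.card A - Multiset.card T) (by omega) (by
    intro x
    have := hcon x
    omega)
  obtain ⟨R, rfl⟩ := Multiset.le_iff_exists_add.1 hle
  have h1 := card_pairSum_le_card_subProds l hne (hT.mono hle)
  have h2 := card_succ_le_card_subProds R (hT.mono (Multiset.le_add_left _ _))
  have h3 := card_subProds_add_le hT
  have h4 := Finset.card_le_univ (subProds (pairSum l + R))
  rw [← Nat.card_eq_fintype_card] at h4
  rw [Multiset.card_add, card_pairSum] at hl hlt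
  omega

/-- An element occurring at least `|A| / 2` times in a product-free multiset has
order more than `|A| / 2`, hence `|A|`. -/
theorem IsProdFree.orderOf_eq [Finite A] {T : Multiset A} (hT : IsProdFree T) {g : A}
    (h : Nat.card A ≤ 2 * T.count g) : orderOf g = Nat.card A := by
  have hlt : T.count g < orderOf g := by
    by_contra! hle
    have h1 := hT (Multiset.replicate (orderOf g) g) (Multiset.le_count_iff_replicate_le.1 hle)
      (by rw [Multiset.prod_replicate, pow_orderOf_eq_one])
    have h2 := congrArg Multiset.card h1
    rw [Multiset.card_replicate, Multiset.card_zero] at h2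
    exact (orderOf_pos g).ne' h2
  obtain ⟨c, hc⟩ := orderOf_dvd_natCard g
  have hpos : 0 < Nat.card A := Nat.card_pos
  have hc2 : c < 2 := by
    by_contra! h2
    have := Nat.mul_le_mul_left (orderOf g) h2
    omega
  interval_cases c
  · omega
  · omega

end SubsequenceProducts

/-! ### Multisets of integers with sum divisible by `2k` -/

theorem Multiset.exists_minimal_le {α : Type*} (P : Multiset α → Prop) (s : Multiset α)
    (hs : P s) : ∃ t ≤ s, P t ∧ ∀ u < t, ¬ P u := by
  induction s using Multiset.strongInductionOn with
  | _ s ih =>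
    by_cases h : ∃ u < s, P u
    · obtain ⟨u, hu, hPu⟩ := h
      obtain ⟨t, ht, h⟩ := ih u hu hPu
      exact ⟨t, ht.trans hu.le, h⟩
    · push Not at h
      exact ⟨s, le_rfl, hs, h⟩

theorem Multiset.count_one_add_filter (S : Multiset ℕ) (hS : ∀ y ∈ S, 1 ≤ y) :
    S = Multiset.replicate (S.count 1) 1 + S.filter (2 ≤ ·) := by
  rw [← Multiset.filter_eq']
  conv_lhs => rw [← Multiset.filter_add_not (2 ≤ ·) S, add_comm]
  congr 1
  refine Multiset.filter_congr fun y hy => ?_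
  have := hS y hy
  omega

/-- A multiset of positive integers all of which lie in `[1, 2k]`, whose sum is divisible by `2k`,
with more than `3k` terms, many of which are `1`, either contains a sub-multiset with sum divisible
by `2k` and size in `[2k + 1, 3k]`, or has at least `2k + 2` ones. Here `3k + 1 + e` is the number
of terms. By complementation it suffices to find sub-multisets of size in `[e + 1, e + k]`; these
are obtained by completing a few large terms by ones to a sum divisible by `2k`. -/
theorem exists_sum_dvd_or_count_one (k e : ℕ) (he : e + 1 ≤ k) (S : Multiset ℕ)
    (hS : ∀ y ∈ S, 1 ≤ y ∧ y ≤ 2 * k) (hsum : 2 * k ∣ S.sum)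
    (hcard : Multiset.card S = 3 * k + 1 + e) (hone : k + e ≤ S.count 1) :
    2 * k + 2 ≤ S.count 1 ∨
      ∃ W ≤ S, 2 * k ∣ W.sum ∧ 2 * k + 1 ≤ Multiset.card W ∧ Multiset.card W ≤ 3 * k := by
  by_contra! hcon
  obtain ⟨hcount, hW⟩ := hcon
  have hV : ∀ V ≤ S, 2 * k ∣ V.sum → e + 1 ≤ Multiset.card V → k + e < Multiset.card V := by
    intro V hVS hVsum h1
    by_contra! h2
    obtain ⟨W, rfl⟩ := Multiset.le_iff_exists_add.1 hVS
    rw [Multiset.sum_add] at hsum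
    rw [Multiset.card_add] at hcard
    have := hW W (Multiset.le_add_left _ _) ((Nat.dvd_add_right hVsum).1 hsum) (by omega)
    omega
  have hdec := S.count_one_add_filter fun y hy => (hS y hy).1
  -- sub-multisets of the terms `≥ 2`, completed by ones
  have hfill : ∀ V ≤ S.filter (2 ≤ ·), ∀ j ≤ k + e, 2 * k ∣ V.sum + j →
      e + 1 ≤ Multiset.card V + j → k + e < Multiset.card V + j := by
    intro V hVS j hj hd h1
    have := hV (Multiset.replicate j 1 + V) (by
      conv_rhs => rw [hdec]
      exact add_le_add (Multiset.replicate_mono _ (by omega)) hVS)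
      (by simpa [add_comm] using hd) (by simpa [add_comm] using h1)
    simpa [add_comm] using this
  have hdich : ∀ y ∈ S.filter (2 ≤ ·), y + e ≤ k ∨ 2 * k + 1 ≤ y + e := by
    intro y hy
    by_contra! h
    have h2 := hS y (Multiset.mem_of_mem_filter hy)
    have h3 := hfill {y} (by simpa using hy) (2 * k - y) (by omega)
      (by simp [h2.2]) (by simp; omega)
    simp at h3
    omega
  set Q := S.filter (2 ≤ ·) with hQ
  set P := Q.filter (fun y => y + e ≤ k) with hP
  set N := Q.filter (fun y => ¬ y + e ≤ k) with hN
  have hPN : P + N = Q := Multiset.filter_add_not _ _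
  have hNmem : ∀ y ∈ N, 2 * k + 1 ≤ y + e ∧ y ≤ 2 * k := by
    intro y hy
    have h1 := Multiset.mem_filter.1 hy
    refine ⟨(hdich y h1.1).resolve_left h1.2, (hS y (Multiset.mem_of_mem_filter h1.1)).2⟩
  have hPmem : ∀ y ∈ P, 2 ≤ y ∧ y + e ≤ k := by
    intro y hy
    have h1 := Multiset.mem_filter.1 hy
    exact ⟨(Multiset.mem_filter.1 h1.1).2, h1.2⟩
  -- the deficits `2 * k + 1 - y` of the large terms
  have hZsum : ∀ V : Multiset ℕ, (∀ y ∈ V, y ≤ 2 * k) →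
      V.sum + (V.map (fun y => 2 * k + 1 - y)).sum = (2 * k + 1) * Multiset.card V := by
    intro V
    induction V using Multiset.induction with
    | empty => simp
    | cons a V ih =>
      intro h
      have h1 := ih fun y hy => h y (Multiset.mem_cons_of_mem hy)
      have h2 := h a (Multiset.mem_cons_self a V)
      simp only [Multiset.sum_cons, Multiset.map_cons, Multiset.card_cons, mul_add, mul_one]
      omega
  have hZ : (N.map (fun y => 2 * k + 1 - y)).sum ≤ e := by
    by_contra! hlt
    obtain ⟨V, hVN, hV1, hV2⟩ := Multiset.exists_minimal_le
      (fun V => e < (V.map (fun y => 2 * k + 1 - y)).sum) N hlt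
    have hVmem : ∀ y ∈ V, y ≤ 2 * k := fun y hy => (hNmem y (Multiset.mem_of_le hVN hy)).2
    have hub : (V.map (fun y => 2 * k + 1 - y)).sum ≤ 2 * e := by
      induction V using Multiset.induction with
      | empty => simp
      | cons a V _ =>
        have h1 := hV2 V (Multiset.lt_cons_self V a)
        have h2 := hNmem a (Multiset.mem_of_le hVN (Multiset.mem_cons_self a V))
        simp only [Multiset.map_cons, Multiset.sum_cons]
        omega
    have hs := hZsum V hVmem
    have hcl : Multiset.card V ≤ (V.map (fun y => 2 * k + 1 - y)).sum := by
      have := Multiset.card_nsmul_le_sum (s := V.map (fun y => 2 * k + 1 - y)) (a := 1) (by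
        intro x hx
        obtain ⟨y, hy, rfl⟩ := Multiset.mem_map.1 hx
        have := hVmem y hy
        omega)
      simpa using this
    have := hfill V (hVN.trans (Multiset.filter_le _ _))
      ((V.map (fun y => 2 * k + 1 - y)).sum - Multiset.card V) (by
        rcases Multiset.empty_or_exists_mem V with rfl | ⟨y, hy⟩
        · simp
        · omega) ⟨Multiset.card V, by rw [add_mul, one_mul] at hs; omega⟩ (by omega)
    omega
  -- the excesses `y - 1` of the moderate terms
  have hDsum : ∀ V : Multiset ℕ, (∀ y ∈ V, 2 ≤ y) →
      V.sum = (V.map (fun y => y - 1)).sum + Multiset.card V ∧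
        Multiset.card V ≤ (V.map (fun y => y - 1)).sum := by
    intro V
    induction V using Multiset.induction with
    | empty => simp
    | cons a V ih =>
      intro h
      have h1 := ih fun y hy => h y (Multiset.mem_cons_of_mem hy)
      have h2 := h a (Multiset.mem_cons_self a V)
      simp only [Multiset.sum_cons, Multiset.map_cons, Multiset.card_cons]
      omega
  have hD : (P.map (fun y => y - 1)).sum + e < k := by
    by_contra! hle
    obtain ⟨V, hVP, hV1, hV2⟩ := Multiset.exists_minimal_le
      (fun V => k ≤ (V.map (fun y => y - 1)).sum + e) P hle
    have hVmem : ∀ y ∈ V, 2 ≤ y ∧ y + e ≤ k := fun y hy => hPmem y (Multiset.mem_of_le hVP hy)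
    have hne : V.toFinset.Nonempty := by
      rw [Multiset.toFinset_nonempty]
      rintro rfl
      simp at hV1
      omega
    -- the smallest term `a` of `V` satisfies `(a - 1) * |V \ a| ≤ k - e - 1`
    obtain ⟨a, ha, hmin⟩ := Finset.exists_min_image V.toFinset id hne
    rw [Multiset.mem_toFinset] at ha
    obtain ⟨V', rfl⟩ := Multiset.exists_cons_of_mem ha
    have h1 := hV2 V' (Multiset.lt_cons_self V' a)
    have h2 := hVmem a ha
    have h3 := hDsum V' fun y hy => (hVmem y (Multiset.mem_cons_of_mem hy)).1
    have h4 : Multiset.card V' * (a - 1) ≤ (V'.map (fun y => y - 1)).sum := by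
      have := Multiset.card_nsmul_le_sum (s := V'.map (fun y => y - 1)) (a := a - 1) (by
        intro x hx
        obtain ⟨y, hy, rfl⟩ := Multiset.mem_map.1 hx
        have := hmin y (by rw [Multiset.mem_toFinset]; exact Multiset.mem_cons_of_mem hy)
        simp only [id] at this
        omega)
      simpa using this
    rw [Multiset.map_cons, Multiset.sum_cons] at hV1
    have h5 : 1 ≤ Multiset.card V' := by
      rw [Nat.one_le_iff_ne_zero, Ne, Multiset.card_eq_zero]
      rintro rfl
      simp at hV1
      omega
    have h6 : Multiset.card V' + (a - 1) ≤ Multiset.card V' * (a - 1) + 1 := by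
      obtain ⟨u, hu⟩ := Nat.exists_eq_add_of_le' h5
      obtain ⟨v, hv⟩ := Nat.exists_eq_add_of_le' (show 1 ≤ a - 1 by omega)
      rw [hu, hv]
      nlinarith [Nat.zero_le (u * v)]
    have h7 := hfill (a ::ₘ V') (hVP.trans (Multiset.filter_le _ _))
      (2 * k - (a ::ₘ V').sum) (by rw [Multiset.sum_cons]; omega)
      ⟨1, by rw [Multiset.sum_cons]; omega⟩
      (by rw [Multiset.sum_cons, Multiset.card_cons]; omega)
    rw [Multiset.sum_cons, Multiset.card_cons] at h7
    omega
  have hPs := hDsum P fun y hy => (hPmem y hy).1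
  have hNs := hZsum N fun y hy => (hNmem y hy).2
  have hNc : Multiset.card N ≤ (N.map (fun y => 2 * k + 1 - y)).sum := by
    have := Multiset.card_nsmul_le_sum (s := N.map (fun y => 2 * k + 1 - y)) (a := 1) (by
      intro x hx
      obtain ⟨y, hy, rfl⟩ := Multiset.mem_map.1 hx
      have := (hNmem y hy).2
      omega)
    simpa using this
  have hsS : S.sum = S.count 1 + (P.sum + N.sum) := by
    conv_lhs => rw [hdec, ← hPN]
    simp
  have hcS : Multiset.card S = S.count 1 + (Multiset.card P + Multiset.card N) := by
    conv_lhs => rw [hdec, ← hPN]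
    simp
  rw [add_mul, one_mul] at hNs
  -- modulo `2 * k`, the sum is `|S| + excess - deficit`, which lies strictly between `2k` and `6k`
  have hdvd : 2 * k ∣ 3 * k + 1 + e + (P.map (fun y => y - 1)).sum
      - (N.map (fun y => 2 * k + 1 - y)).sum := by
    have h1 : S.sum = (3 * k + 1 + e + (P.map (fun y => y - 1)).sum
        - (N.map (fun y => 2 * k + 1 - y)).sum) + 2 * k * Multiset.card N := by omega
    rw [h1] at hsum
    exact (Nat.dvd_add_left (Dvd.intro _ rfl)).1 hsum
  obtain ⟨c, hc⟩ := hdvd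
  have hc1 : c < 3 := by
    by_contra! h
    have := Nat.mul_le_mul_left (2 * k) h
    omega
  interval_cases c <;> omega

/-! ### Minimal blocks and frequent generators -/

/-- A nonempty multiset of product `1` no proper nonempty sub-multiset of which has product `1`. -/
def IsMinimalProdOne {A : Type*} [CommMonoid A] (T : Multiset A) : Prop :=
  T ≠ 0 ∧ T.prod = 1 ∧ ∀ U ≤ T, U.prod = 1 → U = 0 ∨ U = T

section Blocks

variable {A : Type*} [CommGroup A]

theorem exists_isMinimalProdOne_le {S : Multiset A} (h0 : S ≠ 0) (h1 : S.prod = 1) :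
    ∃ T ≤ S, IsMinimalProdOne T := by
  obtain ⟨T, hTS, ⟨hT0, hT1⟩, hmin⟩ :=
    Multiset.exists_minimal_le (fun T => T ≠ 0 ∧ T.prod = 1) S ⟨h0, h1⟩
  refine ⟨T, hTS, hT0, hT1, fun U hU hU1 => ?_⟩
  by_contra! h
  exact hmin U (lt_of_le_of_ne hU h.2) ⟨h.1, hU1⟩

theorem IsMinimalProdOne.isProdFree {a : A} {T : Multiset A}
    (h : IsMinimalProdOne (a ::ₘ T)) : IsProdFree T := by
  intro U hU hU1
  refine (h.2.2 U (hU.trans (Multiset.le_cons_self T a)) hU1).resolve_right fun hc => ?_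
  have := Multiset.card_le_card hU
  rw [hc, Multiset.card_cons] at this
  omega

variable [Finite A] [DecidableEq A]

theorem IsMinimalProdOne.card_le {T : Multiset A} (h : IsMinimalProdOne T) :
    Multiset.card T ≤ Nat.card A := by
  obtain ⟨a, ha⟩ := Multiset.exists_mem_of_ne_zero h.1
  obtain ⟨T, rfl⟩ := Multiset.exists_cons_of_mem ha
  have := h.isProdFree.card_lt
  rw [Multiset.card_cons]
  omega

/-- The weights lemma `exists_sum_dvd_or_count_one` for multisets in a cyclic group, the weight
of `y` being its logarithm in `[1, 2k]` with respect to a frequent generator `g`. -/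
theorem exists_prod_one_or_count (k e : ℕ) (he : e + 1 ≤ k) (hA : Nat.card A = 2 * k) {g : A}
    (hg : orderOf g = 2 * k) (S : Multiset A) (hS : S.prod = 1)
    (hcard : Multiset.card S = 3 * k + 1 + e) (hcount : k + e ≤ S.count g) :
    2 * k + 2 ≤ S.count g ∨
      ∃ W ≤ S, W.prod = 1 ∧ 2 * k + 1 ≤ Multiset.card W ∧ Multiset.card W ≤ 3 * k := by
  have hw : ∀ y : A, ∃ w : ℕ, 1 ≤ w ∧ w ≤ 2 * k ∧ g ^ w = y := by
    intro y
    have hy : y ∈ Submonoid.powers g := by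
      rw [mem_powers_iff_mem_zpowers]
      have : Subgroup.zpowers g = ⊤ := by
        rw [← Subgroup.card_eq_iff_eq_top, Nat.card_zpowers, hg, hA]
      rw [this]
      trivial
    rw [mem_powers_iff_mem_range_orderOf, hg, Finset.mem_image] at hy
    obtain ⟨w, hw, rfl⟩ := hy
    rw [Finset.mem_range] at hw
    rcases Nat.eq_zero_or_pos w with rfl | hpos
    · exact ⟨2 * k, by omega, le_rfl, by rw [← hg, pow_orderOf_eq_one, pow_zero]⟩
    · exact ⟨w, hpos, hw.le, rfl⟩
  choose w hw1 hw2 hw3 using hw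
  have hwg : ∀ y, 1 = w y ↔ g = y := by
    intro y
    refine ⟨fun h => by rw [← hw3 y, ← h, pow_one], ?_⟩
    rintro rfl
    have h1 : g ^ (w g) = g ^ 1 := by rw [hw3, pow_one]
    rw [pow_inj_mod, hg, Nat.mod_eq_of_lt (show 1 < 2 * k by omega)] at h1
    rcases (hw2 g).lt_or_eq with h | h
    · rw [Nat.mod_eq_of_lt h] at h1
      exact h1.symm
    · rw [h, Nat.mod_self] at h1
      omega
  have hprod : ∀ V : Multiset A, V.prod = g ^ (V.map w).sum := by
    intro V
    induction V using Multiset.induction with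
    | empty => simp
    | cons a V ih => simp [pow_add, hw3, ih]
  have hdvd : ∀ V : Multiset A, V.prod = 1 ↔ 2 * k ∣ (V.map w).sum := by
    intro V
    rw [hprod, ← orderOf_dvd_iff_pow_eq_one, hg]
  have hc : (S.map w).count 1 = S.count g := by
    rw [Multiset.count_map, Multiset.count, Multiset.countP_eq_card_filter]
    congr 1
    exact Multiset.filter_congr fun y _ => hwg y
  rcases exists_sum_dvd_or_count_one k e he (S.map w) (by
    intro y hy
    obtain ⟨x, -, rfl⟩ := Multiset.mem_map.1 hy
    exact ⟨hw1 x, hw2 x⟩) ((hdvd S).1 hS) (by simpa using hcard) (by rwa [hc]) with h | h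
  · left
    rwa [hc] at h
  · right
    obtain ⟨W', hW', h1, h2, h3⟩ := h
    obtain ⟨W, hWS, rfl⟩ := Multiset.exists_le_map_eq_of_le_map hW'
    rw [Multiset.card_map] at h2 h3
    exact ⟨W, hWS, (hdvd W).2 h1, h2, h3⟩

/-- A long multiset of product `1` in an abelian group of order `2k` contains either a sub-multiset
of product `1` and size in `[2k + 1, 3k]`, or a generator more than `2k + 1` times. In the absence
of the former, greedy unions of minimal blocks must jump over the whole interval, which produces
two disjoint blocks of total size more than `3k`; the longer one contains a frequent generator. -/
theorem exists_generator_count_or_prod_one (k : ℕ) (hk : 3 ≤ k) (hA : Nat.card A = 2 * k)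
    (S : Multiset A) (hS : S.prod = 1) (hcard : 3 * k < Multiset.card S) :
    (∃ g, orderOf g = 2 * k ∧ 2 * k + 2 ≤ S.count g) ∨
      ∃ W ≤ S, W.prod = 1 ∧ 2 * k + 1 ≤ Multiset.card W ∧ Multiset.card W ≤ 3 * k := by
  rw [or_iff_not_imp_right]
  intro hcon
  have hW : ∀ W ≤ S, W.prod = 1 → Multiset.card W ≤ 3 * k → Multiset.card W ≤ 2 * k := by
    intro W hWS hW1 hWc
    by_contra! h
    exact hcon ⟨W, hWS, hW1, h, hWc⟩
  classical
  obtain ⟨T₀, hT₀S, hT₀⟩ := exists_isMinimalProdOne_le (S := S) (by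
    rintro rfl
    simp at hcard) hS
  -- a longest block `T₁`
  obtain ⟨T₁, hT₁, hT₁max⟩ := Finset.exists_max_image
    (S.powerset.toFinset.filter IsMinimalProdOne) Multiset.card ⟨T₀, by simp [hT₀S, hT₀]⟩
  simp only [Finset.mem_filter, Multiset.mem_toFinset, Multiset.mem_powerset] at hT₁ hT₁max
  -- a largest `X ⊇ T₁` of product `1` and size at most `2k`
  obtain ⟨X, hX, hXmax⟩ := Finset.exists_max_image
    (S.powerset.toFinset.filter fun X => T₁ ≤ X ∧ X.prod = 1 ∧ Multiset.card X ≤ 2 * k)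
    Multiset.card ⟨T₁, by simp [hT₁.1, hT₁.2.2.1, ← hA, hT₁.2.card_le]⟩
  simp only [Finset.mem_filter, Multiset.mem_toFinset, Multiset.mem_powerset] at hX hXmax
  obtain ⟨hXS, hTX, hX1, hXc⟩ := hX
  obtain ⟨R, rfl⟩ := Multiset.le_iff_exists_add.1 hXS
  obtain ⟨T, hTR, hT⟩ := exists_isMinimalProdOne_le (S := R) (by
    rintro rfl
    rw [add_zero] at hcard
    omega) (by rwa [Multiset.prod_add, hX1, one_mul] at hS)
  have hTpos : 0 < Multiset.card T := Multiset.card_pos.2 hT.1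
  have hXT : 3 * k < Multiset.card (X + T) := by
    by_contra! h
    have h1 : (X + T).prod = 1 := by rw [Multiset.prod_add, hX1, hT.2.1, one_mul]
    have h2 : X + T ≤ X + R := add_le_add_right hTR X
    have h3 := hXmax _ ⟨h2, hTX.trans (Multiset.le_add_right _ _), h1, hW _ h2 h1 h⟩
    rw [Multiset.card_add] at h3
    omega
  rw [Multiset.card_add] at hXT
  have hTT₁ := hT₁max T ⟨hTR.trans (Multiset.le_add_left _ _), hT⟩
  have hsub : T₁ + T ≤ X + R := add_le_add hTX hTR
  have hprod : (T₁ + T).prod = 1 := by rw [Multiset.prod_add, hT₁.2.2.1, hT.2.1, one_mul]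
  have hlen : 3 * k < Multiset.card (T₁ + T) := by
    by_contra! h
    have := hW _ hsub hprod h
    rw [Multiset.card_add] at this
    omega
  have hT₁c := hT₁.2.card_le
  rw [Multiset.card_add] at hlen
  obtain ⟨a, ha⟩ := Multiset.exists_mem_of_ne_zero hT₁.2.1
  obtain ⟨T', rfl⟩ := Multiset.exists_cons_of_mem ha
  have hfree := hT₁.2.isProdFree
  rw [Multiset.card_cons] at hT₁c hlen hTT₁
  obtain ⟨g, hg⟩ := hfree.exists_count (by omega)
  have hord := hfree.orderOf_eq (g := g) (by omega)
  have hle := Multiset.count_le_of_le g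
    ((Multiset.le_cons_self T' a).trans (Multiset.le_add_right (a ::ₘ T') T))
  refine ⟨g, by rw [hord, hA], ?_⟩
  rcases exists_prod_one_or_count k (Multiset.card T' + 1 + Multiset.card T - (3 * k + 1))
    (by omega) hA (hord.trans hA) (a ::ₘ T' + T) hprod
    (by rw [Multiset.card_add, Multiset.card_cons]; omega) (by omega) with h | h
  · exact h.trans (Multiset.count_le_of_le g hsub)
  · obtain ⟨W, hWS, h1⟩ := h
    exact absurd ⟨W, hWS.trans hsub, h1⟩ hcon

end Blocks

/-! ### Translations as products of affine maps -/

/-- Affine coordinates on a group `G`: an embedding of `G` into the group of affine maps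
`x ↦ lin g * x + trans g` of the field `F`, given by its linear and translation parts. -/
structure AffineCoords (F G : Type*) [Field F] [Group G] where
  /-- The linear part of an affine map. -/
  lin : G →* Fˣ
  /-- The translation part of an affine map. -/
  trans : G → F
  trans_mul : ∀ g h, trans (g * h) = trans g + lin g * trans h
  eq_one : ∀ g, lin g = 1 → trans g = 0 → g = 1

namespace AffineCoords

variable {F G : Type*} [Field F] [Group G] (κ : AffineCoords F G)

theorem trans_one : κ.trans 1 = 0 := by
  simpa using κ.trans_mul 1 1

theorem eq_of_coords {g h : G} (h1 : κ.lin g = κ.lin h) (h2 : κ.trans g = κ.trans h) : g = h := by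
  rw [← mul_inv_eq_one]
  refine κ.eq_one _ (by rw [map_mul, map_inv, h1, mul_inv_cancel]) ?_
  rw [κ.trans_mul, h1, h2, ← κ.trans_mul, mul_inv_cancel, κ.trans_one]

theorem lin_list_prod (L : List G) :
    κ.lin L.prod = ((L : Multiset G).map κ.lin).prod := by
  simp [map_list_prod]

/-- Conjugation by a prefix of linear part `u` multiplies the value of a translation by `u⁻¹`. -/
theorem trans_mul_comm (x y : G) (h : κ.lin (x * y) = 1) :
    κ.lin x * κ.trans (y * x) = κ.trans (x * y) := by
  have h1 := κ.trans_mul x (y * x)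
  rw [← mul_assoc, κ.trans_mul (x * y) x, h, Units.val_one, one_mul, add_comm] at h1
  exact (add_left_cancel h1).symm

variable [Fintype F]

open Classical in
/-- The translations that are products, in some order, of sub-multisets of `W`. -/
noncomputable def translations (W : Multiset G) : Finset F :=
  Finset.univ.filter fun v => ∃ L : List G, (L : Multiset G) ≤ W ∧ κ.lin L.prod = 1 ∧
    κ.trans L.prod = v

theorem mem_translations {W : Multiset G} {v : F} : v ∈ κ.translations W ↔
    ∃ L : List G, (L : Multiset G) ≤ W ∧ κ.lin L.prod = 1 ∧ κ.trans L.prod = v := by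
  simp [translations]

theorem zero_mem_translations (W : Multiset G) : (0 : F) ∈ κ.translations W :=
  κ.mem_translations.2 ⟨[], by simp, by simp, by simp [κ.trans_one]⟩

/-- For a multiset which is minimal among those with product `1` in the linear parts, the cyclic
rotations of any ordering have distinct products. -/
theorem card_lt_card_translations_of_minimal (W : Multiset G) (h1 : (W.map κ.lin).prod = 1)
    (hmin : ∀ U ≤ W, (U.map κ.lin).prod = 1 → U = 0 ∨ U = W)
    (hfree : ∀ L : List G, (L : Multiset G) ≤ W → L.prod = 1 → L = []) :
    Multiset.card W < (κ.translations W).card := by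
  classical
  induction W using Quotient.inductionOn with
  | _ L =>
  change ((L : Multiset G).map κ.lin).prod = 1 at h1
  change ∀ U ≤ (L : Multiset G), (U.map κ.lin).prod = 1 → U = 0 ∨ U = L at hmin
  change ∀ L' : List G, (L' : Multiset G) ≤ L → L'.prod = 1 → L' = [] at hfree
  change Multiset.card (L : Multiset G) < (κ.translations (L : Multiset G)).card
  rw [← κ.lin_list_prod] at h1
  rw [Multiset.coe_card]
  rcases eq_or_ne L [] with rfl | hL
  · exact Finset.card_pos.2 ⟨0, κ.zero_mem_translations _⟩
  have hP : κ.trans L.prod ≠ 0 := fun h => hL (hfree L le_rfl (κ.eq_one _ h1 h))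
  set f : ℕ → F := fun i => κ.trans ((L.drop i).prod * (L.take i).prod) with hf
  have hrot : ∀ i, κ.lin (L.take i).prod * f i = κ.trans L.prod := by
    intro i
    have h2 : (L.take i).prod * (L.drop i).prod = L.prod := List.prod_take_mul_prod_drop L i
    rw [hf]
    simp only
    rw [κ.trans_mul_comm _ _ (by rw [h2, h1]), h2]
  have hlt : ∀ i j, i < j → j < L.length → f i ≠ f j := by
    intro i j hij hj hfij
    have hi' := hrot i
    have hj' := hrot j
    rw [hfij, ← hj'] at hi'
    have hfj : f j ≠ 0 := by
      intro h0
      rw [h0, mul_zero] at hj'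
      exact hP hj'.symm
    have hlin := Units.ext (mul_right_cancel₀ hfj hi')
    have hseg := List.prod_take_mul_prod_drop (L.take j) i
    rw [List.take_take, min_eq_left hij.le] at hseg
    rw [← hseg, map_mul, left_eq_mul, κ.lin_list_prod] at hlin
    have hsub : ((L.take j).drop i : Multiset G) ≤ L :=
      ((List.drop_sublist _ _).trans (List.take_sublist _ _)).subperm
    rcases hmin _ hsub hlin with h | h
    · have := congrArg Multiset.card h
      simp at this
      omega
    · have := congrArg Multiset.card h
      simp at this
      omega
  have hinj : Set.InjOn f (Finset.range L.length) := by
    intro i hi j hj hfij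
    simp only [Finset.coe_range, Set.mem_Iio] at hi hj
    rcases lt_trichotomy i j with h | h | h
    · exact absurd hfij (hlt i j h hj)
    · exact h
    · exact absurd hfij.symm (hlt j i h hi)
  have hsub : insert 0 ((Finset.range L.length).image f) ⊆ κ.translations (L : Multiset G) := by
    intro v hv
    rcases Finset.mem_insert.1 hv with rfl | hv
    · exact κ.zero_mem_translations _
    · obtain ⟨i, -, rfl⟩ := Finset.mem_image.1 hv
      refine κ.mem_translations.2 ⟨L.drop i ++ L.take i, ?_, ?_, ?_⟩
      · refine le_of_eq (Multiset.coe_eq_coe.2 ?_)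
        conv_rhs => rw [← List.take_append_drop i L]
        exact List.perm_append_comm
      · rw [List.prod_append, map_mul, mul_comm, ← map_mul, List.prod_take_mul_prod_drop, h1]
      · rw [List.prod_append]
  have h0 : (0 : F) ∉ (Finset.range L.length).image f := by
    intro h0
    obtain ⟨i, -, hi⟩ := Finset.mem_image.1 h0
    have := hrot i
    rw [hi, mul_zero] at this
    exact hP this.symm
  have := Finset.card_le_card hsub
  rw [Finset.card_insert_of_notMem h0, Finset.card_image_of_injOn hinj, Finset.card_range] at this
  omega

open scoped Pointwise in
/-- A multiset `W` whose linear parts have product `1`, without product-one sub-multisets, yields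
at least `|W|` nonzero translations: split it into minimal blocks and use Scherk's inequality. -/
theorem card_lt_card_translations (W : Multiset G) (h1 : (W.map κ.lin).prod = 1)
    (hfree : ∀ L : List G, (L : Multiset G) ≤ W → L.prod = 1 → L = []) :
    Multiset.card W < (κ.translations W).card := by
  classical
  induction W using Multiset.strongInductionOn with
  | _ W ih =>
  by_cases hmin : ∀ U ≤ W, (U.map κ.lin).prod = 1 → U = 0 ∨ U = W
  · exact κ.card_lt_card_translations_of_minimal W h1 hmin hfree
  push Not at hmin
  obtain ⟨U, hUW, hU1, hU0, hUne⟩ := hmin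
  obtain ⟨V, rfl⟩ := Multiset.le_iff_exists_add.1 hUW
  have hUlt : U < U + V := lt_of_le_of_ne hUW hUne
  have hVlt : V < U + V := by
    refine lt_of_le_of_ne (Multiset.le_add_left _ _) fun h => hU0 ?_
    exact right_eq_add.1 h
  rw [Multiset.map_add, Multiset.prod_add, hU1, one_mul] at h1
  have ihU := ih U hUlt hU1 fun L hL => hfree L (hL.trans hUlt.le)
  have ihV := ih V hVlt h1 fun L hL => hfree L (hL.trans hVlt.le)
  have happ : ∀ L L' : List G, (L : Multiset G) ≤ U → κ.lin L.prod = 1 → (L' : Multiset G) ≤ V →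
      κ.lin L'.prod = 1 → ((L ++ L' : List G) : Multiset G) ≤ U + V ∧
        κ.lin (L ++ L').prod = 1 ∧ κ.trans (L ++ L').prod = κ.trans L.prod + κ.trans L'.prod := by
    intro L L' hL hL1 hL' hL1'
    refine ⟨?_, ?_, ?_⟩
    · rw [← Multiset.coe_add]
      exact add_le_add hL hL'
    · rw [List.prod_append, map_mul, hL1, hL1', one_mul]
    · rw [List.prod_append, κ.trans_mul, hL1, Units.val_one, one_mul]
  have hsch := Finset.scherk_add (κ.translations U) (κ.translations V)
    (κ.zero_mem_translations U) (κ.zero_mem_translations V) (by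
      intro x hx y hy hxy
      obtain ⟨L, hL, hL1, rfl⟩ := κ.mem_translations.1 hx
      obtain ⟨L', hL', hL1', rfl⟩ := κ.mem_translations.1 hy
      obtain ⟨h2, h3, h4⟩ := happ L L' hL hL1 hL' hL1'
      have := hfree _ h2 (κ.eq_one _ h3 (h4.trans hxy))
      rw [(List.append_eq_nil_iff.1 this).1, List.prod_nil, κ.trans_one])
  have hle := Finset.card_le_card (Finset.add_subset_iff.2 (by
    intro x hx y hy
    obtain ⟨L, hL, hL1, rfl⟩ := κ.mem_translations.1 hx
    obtain ⟨L', hL', hL1', rfl⟩ := κ.mem_translations.1 hy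
    obtain ⟨h2, h3, h4⟩ := happ L L' hL hL1 hL' hL1'
    exact κ.mem_translations.2 ⟨_, h2, h3, h4⟩) :
    κ.translations U + κ.translations V ⊆ κ.translations (U + V))
  rw [Multiset.card_add]
  omega

theorem exists_prod_one_of_card_le (W : Multiset G) (h1 : (W.map κ.lin).prod = 1)
    (hcard : Fintype.card F ≤ Multiset.card W) :
    ∃ L : List G, (L : Multiset G) ≤ W ∧ L.prod = 1 ∧ L ≠ [] := by
  by_contra! hfree
  have h2 := κ.card_lt_card_translations W h1 hfree
  have h3 := Finset.card_le_univ (κ.translations W)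
  omega

end AffineCoords

/-! ### Weighted sums over the nonzero residues -/

section SlotValues

variable {F : Type*} [Field F]

/-- The values `∑ s * c s` over the finite set `U` of slots, where `c` places at the slots of `U`
distinct entries of the multiset `B`. -/
def slotValues (B : Multiset F) (U : Finset F) : Set F :=
  {v | ∃ c : F → F, U.val.map c ≤ B ∧ ∑ s ∈ U, s * c s = v}

theorem slotValues_mono {B B' : Multiset F} (h : B ≤ B') (U : Finset F) :
    slotValues B U ⊆ slotValues B' U := by
  rintro v ⟨c, hc, hv⟩
  exact ⟨c, hc.trans h, hv⟩

theorem mul_mem_slotValues (s x : F) : s * x ∈ slotValues {x} {s} :=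
  ⟨fun _ => x, by simp, by simp⟩

variable [DecidableEq F]

theorem add_mem_slotValues {B B' : Multiset F} {U U' : Finset F} {v v' : F}
    (h : v ∈ slotValues B U) (h' : v' ∈ slotValues B' U') (hd : Disjoint U U') :
    v + v' ∈ slotValues (B + B') (U ∪ U') := by
  obtain ⟨c, hc, rfl⟩ := h
  obtain ⟨c', hc', rfl⟩ := h'
  have hU : ∀ s ∈ U, (if s ∈ U then c s else c' s) = c s := fun s hs => if_pos hs
  have hU' : ∀ s ∈ U', (if s ∈ U then c s else c' s) = c' s :=
    fun s hs => if_neg (Finset.disjoint_right.1 hd hs)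
  refine ⟨fun s => if s ∈ U then c s else c' s, ?_, ?_⟩
  · rw [← Finset.disjUnion_eq_union _ _ hd, Finset.disjUnion_val, Multiset.map_add,
      Multiset.map_congr rfl fun s hs => hU s hs, Multiset.map_congr rfl fun s hs => hU' s hs]
    exact add_le_add hc hc'
  · rw [Finset.sum_union hd]
    congr 1
    · exact Finset.sum_congr rfl fun s hs => congrArg (s * ·) (hU s hs)
    · exact Finset.sum_congr rfl fun s hs => congrArg (s * ·) (hU' s hs)

theorem slotValues_nonempty (U : Finset F) (B : Multiset F) (h : U.card ≤ Multiset.card B) :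
    (slotValues B U).Nonempty := by
  induction U using Finset.induction_on generalizing B with
  | empty => exact ⟨0, fun _ => 0, by simp, by simp⟩
  | insert s U hs ih =>
    rw [Finset.card_insert_of_notMem hs] at h
    obtain ⟨x, hx⟩ := Multiset.card_pos_iff_exists_mem.1 (show 0 < Multiset.card B by omega)
    obtain ⟨B, rfl⟩ := Multiset.exists_cons_of_mem hx
    rw [Multiset.card_cons] at h
    obtain ⟨v, hv⟩ := ih B (by omega)
    refine ⟨s * x + v, ?_⟩
    rw [← Multiset.singleton_add, Finset.insert_eq]
    exact add_mem_slotValues (mul_mem_slotValues s x) hv (by simpa using hs)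

theorem pair_mem_slotValues {s t : F} (hst : s ≠ t) (x y : F) :
    s * x + t * y ∈ slotValues {x, y} {s, t} := by
  rw [Finset.insert_eq, Multiset.insert_eq_cons, ← Multiset.singleton_add]
  exact add_mem_slotValues (mul_mem_slotValues s x) (mul_mem_slotValues t y) (by simpa using hst)

end SlotValues

section ZModSlots

variable {p : ℕ} [Fact p.Prime]

/-- Two pairs of distinct elements, each offering a choice for one slot, realise four consecutive
values. -/
theorem exists_two_slots (hp : 2 < p) (x y : ZMod p × ZMod p) (hx : x.1 ≠ x.2) (hy : y.1 ≠ y.2) :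
    ∃ U : Finset (ZMod p), 0 ∉ U ∧ U.card = 2 ∧ ∃ v₀ : ZMod p, ∀ k < 4,
      v₀ + ((k : ℕ) : ZMod p) ∈ slotValues (pairSum [x, y]) U := by
  have hx' : x.2 - x.1 ≠ 0 := sub_ne_zero.2 hx.symm
  have hy' : y.2 - y.1 ≠ 0 := sub_ne_zero.2 hy.symm
  have h2 : (2 : ZMod p) ≠ 0 := by
    intro h
    have : ((2 : ℕ) : ZMod p) = 0 := by exact_mod_cast h
    rw [ZMod.natCast_eq_zero_iff] at this
    exact absurd (Nat.le_of_dvd (by norm_num) this) (by omega)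
  have key : ∀ s t : ZMod p, s ≠ t → ∀ x' y' : ZMod p, (x' = x.1 ∨ x' = x.2) →
      (y' = y.1 ∨ y' = y.2) → s * x' + t * y' ∈ slotValues (pairSum [x, y]) {s, t} := by
    intro s t hst x' y' hx' hy'
    rw [Finset.insert_eq, pairSum_cons, pairSum_cons, pairSum_nil, add_zero]
    refine add_mem_slotValues (slotValues_mono ?_ _ (mul_mem_slotValues s x'))
      (slotValues_mono ?_ _ (mul_mem_slotValues t y')) (by simpa using hst)
    · rcases hx' with rfl | rfl <;> simp
    · rcases hy' with rfl | rfl <;> simp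
  set s := (x.2 - x.1)⁻¹ with hs
  have hs0 : s ≠ 0 := inv_ne_zero hx'
  have hs1 : s * (x.2 - x.1) = 1 := inv_mul_cancel₀ hx'
  set t := 2 * (y.2 - y.1)⁻¹ with ht
  have ht0 : t ≠ 0 := mul_ne_zero h2 (inv_ne_zero hy')
  have ht1 : t * (y.2 - y.1) = 2 := by rw [ht, mul_assoc, inv_mul_cancel₀ hy', mul_one]
  by_cases hst : s = t
  · -- the slots `s` and `-t` realise the differences `1` and `-2`
    have hst' : s ≠ -t := by
      rw [hst]
      intro h
      rw [eq_neg_iff_add_eq_zero, ← two_mul] at h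
      exact mul_ne_zero h2 ht0 h
    refine ⟨{s, -t}, by simp [hs0.symm, ht0], Finset.card_pair hst',
      s * x.1 + -t * y.2, fun k hk => ?_⟩
    interval_cases k
    · convert key s (-t) hst' x.1 y.2 (by simp) (by simp) using 1
      simp
    · convert key s (-t) hst' x.2 y.2 (by simp) (by simp) using 1
      push_cast
      linear_combination -hs1
    · convert key s (-t) hst' x.1 y.1 (by simp) (by simp) using 1
      push_cast
      linear_combination -ht1
    · convert key s (-t) hst' x.2 y.1 (by simp) (by simp) using 1
      push_cast
      linear_combination -hs1 - ht1
  · refine ⟨{s, t}, by simp [hs0.symm, ht0.symm], Finset.card_pair hst,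
      s * x.1 + t * y.1, fun k hk => ?_⟩
    interval_cases k
    · convert key s t hst x.1 y.1 (by simp) (by simp) using 1
      simp
    · convert key s t hst x.2 y.1 (by simp) (by simp) using 1
      push_cast
      linear_combination -hs1
    · convert key s t hst x.1 y.2 (by simp) (by simp) using 1
      push_cast
      linear_combination -ht1
    · convert key s t hst x.2 y.2 (by simp) (by simp) using 1
      push_cast
      linear_combination -hs1 - ht1

/-- Binary expansion by exchanges: each further pair of distinct elements, placed in either order
at two free slots whose difference is prescribed, doubles the interval of values realised. -/
theorem exists_slots_interval (x y : ZMod p × ZMod p) (hx : x.1 ≠ x.2) (hy : y.1 ≠ y.2)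
    (l : List (ZMod p × ZMod p)) (hl : ∀ z ∈ l, z.1 ≠ z.2) (hp : 4 * l.length + 2 < p) :
    ∃ U : Finset (ZMod p), 0 ∉ U ∧ U.card = 2 * l.length + 2 ∧ ∃ v₀ : ZMod p,
      ∀ k < 2 ^ (l.length + 2),
        v₀ + ((k : ℕ) : ZMod p) ∈ slotValues (pairSum l + pairSum [x, y]) U := by
  induction l with
  | nil =>
    obtain ⟨U, h1, h2, v, hv⟩ := exists_two_slots (by simpa using hp) x y hx hy
    exact ⟨U, h1, by simpa using h2, v, fun k hk => by
      simpa only [pairSum_nil, zero_add] using hv k (by simpa using hk)⟩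
  | cons z l ih =>
    rw [List.length_cons] at hp ⊢
    obtain ⟨U, hU0, hUc, v₀, hv⟩ := ih (fun w hw => hl w (List.mem_cons_of_mem _ hw)) (by omega)
    have hz : z.2 - z.1 ≠ 0 := sub_ne_zero.2 (hl z List.mem_cons_self).symm
    have h2 : (2 : ZMod p) ≠ 0 := by
      intro h
      have : ((2 : ℕ) : ZMod p) = 0 := by exact_mod_cast h
      rw [ZMod.natCast_eq_zero_iff] at this
      exact absurd (Nat.le_of_dvd (by norm_num) this) (by omega)
    set e : ZMod p := 2 ^ (l.length + 2) * (z.2 - z.1)⁻¹ with he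
    have he0 : e ≠ 0 := mul_ne_zero (pow_ne_zero _ h2) (inv_ne_zero hz)
    have he1 : e * (z.2 - z.1) = 2 ^ (l.length + 2) := by
      rw [he, mul_assoc, inv_mul_cancel₀ hz, mul_one]
    -- a free slot `s` such that `s + e` is free too
    obtain ⟨s, hs⟩ : ∃ s, s ∉ insert 0 U ∪ (insert 0 U).image (fun t => t - e) := by
      by_contra! hall
      have h1 : (Finset.univ : Finset (ZMod p)).card ≤ _ :=
        Finset.card_le_card fun s _ => hall s
      have h3 := Finset.card_union_le (insert 0 U) ((insert 0 U).image (fun t => t - e))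
      have h4 := Finset.card_image_le (s := insert 0 U) (f := fun t => t - e)
      rw [Finset.card_insert_of_notMem hU0] at h3 h4
      rw [Finset.card_univ, ZMod.card] at h1
      omega
    rw [Finset.mem_union, not_or, Finset.mem_insert, not_or, Finset.mem_image] at hs
    obtain ⟨⟨hs0, hsU⟩, hse⟩ := hs
    have hse' : s + e ∉ insert 0 U := fun h => hse ⟨s + e, h, by ring⟩
    rw [Finset.mem_insert, not_or] at hse'
    have hne : s + e ≠ s := by simpa using he0
    have hd : Disjoint ({s + e, s} : Finset (ZMod p)) U := by
      rw [Finset.disjoint_left]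
      intro a ha
      rw [Finset.mem_insert, Finset.mem_singleton] at ha
      rcases ha with rfl | rfl
      · exact hse'.2
      · exact hsU
    refine ⟨{s + e, s} ∪ U, ?_, ?_, (s + e) * z.1 + s * z.2 + v₀, fun k hk => ?_⟩
    · simp [hU0, Ne.symm hs0, Ne.symm hse'.1]
    · rw [Finset.card_union_of_disjoint hd, Finset.card_pair hne, hUc]
      omega
    rw [pairSum_cons, add_assoc]
    rcases lt_or_ge k (2 ^ (l.length + 2)) with hlt | hge
    · rw [add_assoc]
      exact add_mem_slotValues (pair_mem_slotValues hne z.1 z.2) (hv k hlt) hd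
    · have hlt : k - 2 ^ (l.length + 2) < 2 ^ (l.length + 2) := by
        rw [show l.length + 1 + 2 = (l.length + 2) + 1 by ring, pow_succ] at hk
        omega
      have h3 := add_mem_slotValues (pair_mem_slotValues hne z.2 z.1)
        (hv (k - 2 ^ (l.length + 2)) hlt) hd
      rw [Multiset.pair_comm] at h3
      convert h3 using 1
      rw [Nat.cast_sub hge]
      push_cast
      linear_combination -he1

theorem exists_le_two_pow (hp : 5 < p) : ∃ j, p ≤ 2 ^ (j + 2) ∧ 4 * j + 2 < p := by
  have hprime : p.Prime := Fact.out
  have hex : ∃ j, p ≤ 2 ^ (j + 2) := ⟨p, by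
    have := Nat.lt_two_pow_self (n := p)
    rw [pow_add]
    omega⟩
  classical
  refine ⟨Nat.find hex, Nat.find_spec hex, ?_⟩
  have hmin := fun m => Nat.find_min hex (m := m)
  rcases hj : Nat.find hex with _ | j
  · omega
  have h1 := hmin j (by omega)
  have h6 : p ≠ 6 := by rintro rfl; exact absurd hprime (by norm_num)
  rcases j with _ | j
  · omega
  have h9 : p ≠ 9 := by rintro rfl; exact absurd hprime (by norm_num)
  have h10 : p ≠ 10 := by rintro rfl; exact absurd hprime (by norm_num)
  rcases j with _ | j
  · norm_num at h1 ⊢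
    omega
  have h3 : ∀ i : ℕ, 4 * i + 14 ≤ 2 ^ (i + 4) := by
    intro i
    induction i with
    | zero => norm_num
    | succ i ih => rw [show i + 1 + 4 = (i + 4) + 1 by ring, pow_succ]; omega
  have := h3 j
  rw [show j + 1 + 1 + 2 = j + 4 by ring] at h1
  omega

theorem sum_nonzero_eq_zero (hp : 2 < p) : ∑ s ∈ Finset.univ.erase (0 : ZMod p), s = 0 := by
  rw [Finset.sum_erase (f := fun s : ZMod p => s) _ rfl]
  have h := FiniteField.sum_pow_lt_card_sub_one (K := ZMod p) 1 (by rw [ZMod.card]; omega)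
  simpa using h

/-- If `0` occurs in `B` at least `(p - 1) / 2` times, but fewer than `p - 1` times, fill most
slots by zeros. With `c + c' ≠ 0`, the last two nonzero entries `c`, `c'` are placed on a line
`c * X + c' * Y = -v`, which has enough points to avoid the occupied slots. -/
theorem zero_mem_slotValues_of_count_zero (hp : 5 < p) (B : Multiset (ZMod p))
    (hB : p + 1 ≤ Multiset.card B) (h1 : p ≤ 2 * B.count 0 + 1) (h2 : B.count 0 + 2 ≤ p) :
    0 ∈ slotValues B (Finset.univ.erase 0) := by
  set m := B.count 0 with hm
  have hdec : Multiset.replicate m 0 + B.filter (fun x => ¬ x = 0) = B := by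
    rw [hm, ← Multiset.filter_eq', Multiset.filter_add_not]
  set C := B.filter (fun x => ¬ x = 0) with hC
  have hC0 : ∀ x ∈ C, x ≠ 0 := fun x hx => (Multiset.mem_filter.1 hx).2
  have hp2 : (2 : ZMod p) ≠ 0 := by
    intro h
    have : ((2 : ℕ) : ZMod p) = 0 := by exact_mod_cast h
    rw [ZMod.natCast_eq_zero_iff] at this
    have := Nat.le_of_dvd (by norm_num) this
    have := (Fact.out : p.Prime).two_le
    omega
  have hcard : p + 1 ≤ m + Multiset.card C := by
    rw [← hdec, Multiset.card_add, Multiset.card_replicate] at hB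
    exact hB
  obtain ⟨c, c', C', hCC, hcc⟩ : ∃ c c' C', C = c ::ₘ c' ::ₘ C' ∧ c + c' ≠ 0 := by
    obtain ⟨x, hx⟩ := Multiset.card_pos_iff_exists_mem.1 (show 0 < Multiset.card C by omega)
    obtain ⟨C₁, hC₁⟩ := Multiset.exists_cons_of_mem hx
    rw [hC₁, Multiset.card_cons] at hcard
    obtain ⟨y, hy⟩ := Multiset.card_pos_iff_exists_mem.1 (show 0 < Multiset.card C₁ by omega)
    obtain ⟨C₂, rfl⟩ := Multiset.exists_cons_of_mem hy
    rw [Multiset.card_cons] at hcard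
    obtain ⟨z, hz⟩ := Multiset.card_pos_iff_exists_mem.1 (show 0 < Multiset.card C₂ by omega)
    obtain ⟨C₃, rfl⟩ := Multiset.exists_cons_of_mem hz
    by_contra! hcon
    have e1 := hcon x y _ hC₁
    have e2 := hcon x z (y ::ₘ C₃) (by rw [hC₁, Multiset.cons_swap y z])
    have e3 := hcon y z (x ::ₘ C₃) (by
      rw [hC₁, Multiset.cons_swap x y, Multiset.cons_swap x z])
    refine hC0 x hx ((mul_eq_zero.1 (?_ : 2 * x = 0)).resolve_left hp2)
    linear_combination e1 + e2 - e3
  have hc0 : c ≠ 0 := hC0 c (by simp [hCC])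
  have hc'0 : c' ≠ 0 := hC0 c' (by simp [hCC])
  rw [hCC, Multiset.card_cons, Multiset.card_cons] at hcard
  have hslots : (Finset.univ.erase (0 : ZMod p)).card = p - 1 := by
    rw [Finset.card_erase_of_mem (Finset.mem_univ _), Finset.card_univ, ZMod.card]
  obtain ⟨U, hUsub, hUc⟩ := Finset.exists_subset_card_eq
    (show p - 3 - m ≤ (Finset.univ.erase (0 : ZMod p)).card by omega)
  have hU0 : (0 : ZMod p) ∉ U := fun h => by simpa using hUsub h
  obtain ⟨v, hv⟩ := slotValues_nonempty U C' (by omega)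
  obtain ⟨X, hX⟩ : ∃ X, X ∉ insert (-v / (c + c'))
      (insert 0 U ∪ (insert 0 U).image (fun Y => (-v - c' * Y) / c)) := by
    by_contra! hall
    have h1 : (Finset.univ : Finset (ZMod p)).card ≤ _ :=
      Finset.card_le_card fun s _ => hall s
    have h2 := Finset.card_insert_le (-v / (c + c'))
      (insert 0 U ∪ (insert 0 U).image (fun Y => (-v - c' * Y) / c))
    have h3 := Finset.card_union_le (insert 0 U) ((insert 0 U).image (fun Y => (-v - c' * Y) / c))
    have h4 := Finset.card_image_le (s := insert 0 U) (f := fun Y => (-v - c' * Y) / c)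
    rw [Finset.card_insert_of_notMem hU0] at h3 h4
    rw [Finset.card_univ, ZMod.card] at h1
    omega
  rw [Finset.mem_insert, not_or, Finset.mem_union, not_or, Finset.mem_image] at hX
  obtain ⟨hXl, hXU, hXY⟩ := hX
  set Y := (-v - c * X) / c' with hY
  have hline : X * c + Y * c' = -v := by
    rw [hY]
    field_simp
    ring
  have hYU : Y ∉ insert 0 U := fun h => hXY ⟨Y, h, by
    rw [div_eq_iff hc0]
    linear_combination -hline⟩
  have hne : X ≠ Y := by
    intro h
    refine hXl ?_
    rw [eq_div_iff hcc]
    rw [← h] at hline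
    linear_combination hline
  rw [Finset.mem_insert, not_or] at hXU hYU
  have hd : Disjoint ({X, Y} : Finset (ZMod p)) U := by
    rw [Finset.disjoint_left]
    intro a ha
    rw [Finset.mem_insert, Finset.mem_singleton] at ha
    rcases ha with rfl | rfl
    · exact hXU.2
    · exact hYU.2
  have hsub : {X, Y} ∪ U ⊆ Finset.univ.erase (0 : ZMod p) := by
    intro a ha
    rw [Finset.mem_union, Finset.mem_insert, Finset.mem_singleton] at ha
    rw [Finset.mem_erase]
    refine ⟨?_, Finset.mem_univ _⟩
    rintro rfl
    rcases ha with (h | h) | h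
    · exact hXU.1 h.symm
    · exact hYU.1 h.symm
    · exact hU0 h
  have hrest : (0 : ZMod p) ∈ slotValues (Multiset.replicate m 0)
      (Finset.univ.erase 0 \ ({X, Y} ∪ U)) := by
    refine ⟨fun _ => 0, ?_, by simp⟩
    rw [Multiset.map_const', Finset.card_val, Finset.card_sdiff_of_subset hsub,
      Finset.card_union_of_disjoint hd, Finset.card_pair hne, hUc, hslots]
    exact Multiset.replicate_mono _ (by omega)
  have := add_mem_slotValues (add_mem_slotValues (pair_mem_slotValues hne c c') hv hd) hrest
    Finset.disjoint_sdiff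
  rw [Finset.union_sdiff_of_subset hsub, hline, neg_add_cancel, add_zero] at this
  refine slotValues_mono (le_of_eq ?_) _ this
  rw [← hdec, hCC, add_comm]
  simp

/-- Any `p + 1` elements of `ZMod p` contain `p - 1` elements that can be placed at the nonzero
slots `s` so that `∑ s * c s = 0`. -/
theorem zero_mem_slotValues (hp : 5 < p) (B : Multiset (ZMod p)) (hB : p + 1 ≤ Multiset.card B) :
    0 ∈ slotValues B (Finset.univ.erase 0) := by
  have hslots : (Finset.univ.erase (0 : ZMod p)).card = p - 1 := by
    rw [Finset.card_erase_of_mem (Finset.mem_univ _), Finset.card_univ, ZMod.card]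
  have hsum := sum_nonzero_eq_zero (p := p) (by omega)
  by_cases hm : ∃ b, p ≤ 2 * B.count b + 1
  · obtain ⟨b, hb⟩ := hm
    -- adding a constant to all entries does not change the values, so `b = 0` may be assumed
    obtain ⟨c, hc, hc0⟩ : 0 ∈ slotValues (B.map (· - b)) (Finset.univ.erase 0) := by
      have hcount : (B.map (· - b)).count 0 = B.count b := by
        have := Multiset.count_map_eq_count' (· - b) B (sub_left_injective (b := b)) b
        rwa [sub_self] at this
      by_cases hbig : p - 1 ≤ B.count b
      · refine ⟨fun _ => 0, ?_, by simp⟩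
        rw [Multiset.map_const', Finset.card_val, hslots]
        exact Multiset.le_count_iff_replicate_le.1 (by rwa [hcount])
      · exact zero_mem_slotValues_of_count_zero hp _ (by simpa using hB) (by rwa [hcount])
          (by rw [hcount]; omega)
    refine ⟨fun s => c s + b, ?_, ?_⟩
    · have := Multiset.map_le_map (f := (· + b)) hc
      simpa [Multiset.map_map, Function.comp_def] using this
    · simp_rw [mul_add]
      rw [Finset.sum_add_distrib, hc0, ← Finset.sum_mul, hsum, zero_mul, add_zero]
  · push Not at hm
    obtain ⟨j, hj1, hj2⟩ := exists_le_two_pow hp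
    obtain ⟨l, hl, hne, hle⟩ := B.exists_pairs (j + 2) (by omega) (by
      intro x
      have := hm x
      omega)
    match l, hl, hne, hle with
    | x :: y :: l, hl, hne, hle =>
    rw [List.length_cons, List.length_cons] at hl
    obtain rfl : l.length = j := by omega
    have hsplit : pairSum (x :: y :: l) = pairSum l + pairSum [x, y] := by
      simp only [pairSum_cons, pairSum_nil, add_zero]
      rw [← add_assoc, add_comm]
    obtain ⟨U, hU0, hUc, v₀, hv⟩ := exists_slots_interval x y (hne x (by simp)) (hne y (by simp))
      l (fun z hz => hne z (by simp [hz])) hj2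
    obtain ⟨R, rfl⟩ := Multiset.le_iff_exists_add.1 hle
    rw [Multiset.card_add, card_pairSum, List.length_cons, List.length_cons] at hB
    have hsub : U ⊆ Finset.univ.erase 0 := fun s hs =>
      Finset.mem_erase.2 ⟨fun h => hU0 (h ▸ hs), Finset.mem_univ _⟩
    obtain ⟨w, hw⟩ := slotValues_nonempty (Finset.univ.erase 0 \ U) R (by
      rw [Finset.card_sdiff_of_subset hsub, hUc, hslots]
      omega)
    have hk := hv (-w - v₀).val ((ZMod.val_lt _).trans_le hj1)
    rw [ZMod.natCast_zmod_val, ← hsplit] at hk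
    have := add_mem_slotValues hk hw Finset.disjoint_sdiff
    rw [Finset.union_sdiff_of_subset hsub] at this
    convert this using 1
    ring

end ZModSlots

/-! ### Product-one subsequences of the holomorph -/

namespace AffineCoords

variable {p : ℕ} [Fact p.Prime] {G : Type*} [Group G] (κ : AffineCoords (ZMod p) G)

/-- The product of elements with the same linear part `g`: its translation part weights the terms
by the powers of `g`. -/
theorem coords_prod_range (g : (ZMod p)ˣ) (f : ℕ → G) (hf : ∀ i, κ.lin (f i) = g) (m : ℕ) :
    κ.lin ((List.range m).map f).prod = g ^ m ∧
      κ.trans ((List.range m).map f).prod =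
        ∑ i ∈ Finset.range m, (g : ZMod p) ^ i * κ.trans (f i) := by
  induction m with
  | zero => simp [κ.trans_one]
  | succ m ih =>
    rw [List.range_succ, List.map_append, List.prod_append, List.map_singleton,
      List.prod_singleton, map_mul, κ.trans_mul, ih.1, ih.2, hf, Finset.sum_range_succ, pow_succ]
    simp

/-- The powers of a generator `g` of the multiplicative group are the nonzero slots, so an
assignment of translation parts to the slots with value `0` is an ordering with product `1`. -/
theorem exists_prod_one_of_count (hp : 5 < p) (S : Multiset G) (g : (ZMod p)ˣ)
    (hg : orderOf g = p - 1) (hcount : p + 1 ≤ (S.map κ.lin).count g) :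
    ∃ L : List G, (L : Multiset G) ≤ S ∧ L.prod = 1 ∧ L.length = p - 1 := by
  set S₁ := S.filter (fun x => g = κ.lin x) with hS₁
  have hcard : p + 1 ≤ Multiset.card S₁ := by rwa [Multiset.count_map] at hcount
  have hlin : ∀ x ∈ S₁, κ.lin x = g := fun x hx => (Multiset.mem_filter.1 hx).2.symm
  obtain ⟨c, hc, hsum⟩ := zero_mem_slotValues hp (S₁.map κ.trans) (by simpa using hcard)
  -- among elements with linear part `g`, the translation part determines the element
  obtain ⟨x₀, hx₀⟩ := Multiset.card_pos_iff_exists_mem.1 (show 0 < Multiset.card S₁ by omega)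
  have hσ : ∀ v, ∃ x, κ.lin x = g ∧ (v ∈ S₁.map κ.trans → κ.trans x = v) := by
    intro v
    by_cases hv : v ∈ S₁.map κ.trans
    · obtain ⟨x, hx, rfl⟩ := Multiset.mem_map.1 hv
      exact ⟨x, hlin x hx, fun _ => rfl⟩
    · exact ⟨x₀, hlin x₀ hx₀, fun h => absurd h hv⟩
  choose σ hσ1 hσ2 using hσ
  have hσS : (S₁.map κ.trans).map σ = S₁ := by
    rw [Multiset.map_map]
    conv_rhs => rw [← Multiset.map_id S₁]
    refine Multiset.map_congr rfl fun x hx => ?_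
    exact κ.eq_of_coords ((hσ1 _).trans (hlin x hx).symm)
      (hσ2 _ (Multiset.mem_map_of_mem _ hx))
  have hinj : Set.InjOn (fun i : ℕ => (g : ZMod p) ^ i) (Finset.range (p - 1)) := by
    intro i hi j hj hij
    simp only [Finset.coe_range, Set.mem_Iio] at hi hj
    have : g ^ i = g ^ j := Units.ext (by simpa using hij)
    rw [pow_inj_mod, hg, Nat.mod_eq_of_lt hi, Nat.mod_eq_of_lt hj] at this
    exact this
  have hslots : (Finset.range (p - 1)).image (fun i : ℕ => (g : ZMod p) ^ i)
      = Finset.univ.erase 0 := by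
    refine Finset.eq_of_subset_of_card_le ?_ ?_
    · intro s hs
      obtain ⟨i, -, rfl⟩ := Finset.mem_image.1 hs
      exact Finset.mem_erase.2 ⟨pow_ne_zero _ g.ne_zero, Finset.mem_univ _⟩
    · rw [Finset.card_image_of_injOn hinj, Finset.card_range,
        Finset.card_erase_of_mem (Finset.mem_univ _), Finset.card_univ, ZMod.card]
  have hval : (Finset.univ.erase (0 : ZMod p)).val
      = (Multiset.range (p - 1)).map (fun i : ℕ => (g : ZMod p) ^ i) := by
    rw [← hslots, Finset.image_val_of_injOn hinj, Finset.range_val]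
  obtain ⟨h1, h2⟩ := κ.coords_prod_range g (fun i => σ (c ((g : ZMod p) ^ i)))
    (fun i => hσ1 _) (p - 1)
  refine ⟨(List.range (p - 1)).map fun i => σ (c ((g : ZMod p) ^ i)), ?_, ?_, by simp⟩
  · refine le_trans ?_ (Multiset.filter_le (fun x => g = κ.lin x) S)
    rw [← hS₁, ← hσS, ← Multiset.map_coe, Multiset.coe_range]
    have := Multiset.map_le_map (f := σ) hc
    rw [hval, Multiset.map_map, Multiset.map_map] at this
    exact this
  · refine κ.eq_one _ (by rw [h1, ← hg, pow_orderOf_eq_one]) ?_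
    rw [h2, ← hsum, ← hslots, Finset.sum_image hinj]
    refine Finset.sum_congr rfl fun i hi => ?_
    rw [hσ2]
    refine Multiset.mem_of_le hc (Multiset.mem_map_of_mem _ ?_)
    rw [← hslots]
    exact Finset.mem_image_of_mem _ hi

theorem exists_short_prod_one {k : ℕ} (hk : p = 2 * k + 1) (hp : 5 < p) (S : Multiset G)
    (hS : (S.map κ.lin).prod = 1) (hcard : 3 * k < Multiset.card S) :
    ∃ L : List G, (L : Multiset G) ≤ S ∧ L.prod = 1 ∧ L ≠ [] ∧ L.length ≤ 3 * k := by
  have hA : Nat.card (ZMod p)ˣ = 2 * k := by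
    rw [Nat.card_eq_fintype_card, ZMod.card_units, hk, Nat.add_sub_cancel]
  rcases exists_generator_count_or_prod_one k (by omega) hA (S.map κ.lin) hS
    (by rwa [Multiset.card_map]) with ⟨g, hg, hcount⟩ | ⟨W', hW', h1, h2, h3⟩
  · obtain ⟨L, hLS, hL1, hL⟩ := κ.exists_prod_one_of_count hp S g (by omega) (by omega)
    refine ⟨L, hLS, hL1, ?_, by omega⟩
    rintro rfl
    rw [List.length_nil] at hL
    omega
  · obtain ⟨W, hWS, rfl⟩ := Multiset.exists_le_map_eq_of_le_map hW'
    rw [Multiset.card_map] at h2 h3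
    obtain ⟨L, hLW, hL1, hL0⟩ := κ.exists_prod_one_of_card_le W h1 (by rw [ZMod.card]; omega)
    refine ⟨L, hLW.trans hWS, hL1, hL0, ?_⟩
    have := Multiset.card_le_card hLW
    rw [Multiset.coe_card] at this
    omega

theorem mem_eSet (κ : AffineCoords (ZMod p) G) {k : ℕ} (hk : p = 2 * k + 1) (hp : 5 < p) :
    3 * k ∈ eSet G := by
  refine ⟨by omega, fun S hS => ?_⟩
  rcases le_or_gt S.length (3 * k) with hle | hlt
  · exact ⟨S, List.Sublist.refl S, hS, hle⟩
  obtain ⟨-, L, hLS, hL1⟩ := hS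
  obtain ⟨L', hL', hL'1, hL'0, hlen⟩ := κ.exists_short_prod_one hk hp S (by
    rw [← Multiset.coe_eq_coe.2 hLS, ← κ.lin_list_prod, hL1, map_one])
    (by rwa [Multiset.coe_card])
  obtain ⟨T, hT, hTS⟩ := hL'
  refine ⟨T, hTS, ⟨?_, L', hT.symm, hL'1⟩, hT.length_eq ▸ hlen⟩
  rintro rfl
  exact hL'0 (List.nil_perm.1 hT)

end AffineCoords

/-- Hence `f(G) ≤ e(G)`: a sequence of length `d(G)` contains a product-one sequence. -/
theorem eSet_subset_fSet (G : Type*) [Group G] [Finite G] : eSet G ⊆ fSet G := by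
  rintro m ⟨hm, h⟩
  refine ⟨hm, fun S hS => ?_⟩
  obtain ⟨T, hTS, hT⟩ := (davenportConst_isLeast G).1.2 S hS
  obtain ⟨U, hUT, hU, hUm⟩ := h T hT
  exact ⟨U, hUT.trans hTS, hU, hUm⟩

theorem toAdd_mulAut_apply {n : ℕ} (f : MulAut (Multiplicative (ZMod n))) (x : ZMod n) :
    (f (Multiplicative.ofAdd x)).toAdd = (f (Multiplicative.ofAdd 1)).toAdd * x := by
  have h := map_zpow f (Multiplicative.ofAdd (1 : ZMod n)) (x.cast : ℤ)
  rw [← ofAdd_zsmul, zsmul_one, ZMod.intCast_zmod_cast] at h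
  rw [h, toAdd_zpow, zsmul_eq_mul, ZMod.intCast_zmod_cast, mul_comm]

/-- The element `(b, f)` of the holomorph of `ℤ/n` acts as the affine map `x ↦ f 1 * x + b`. -/
def Hol.affineCoords (p : ℕ) [Fact p.Prime] :
    AffineCoords (ZMod p) (Hol (Multiplicative (ZMod p))) where
  lin := (show MulAut (Multiplicative (ZMod p)) →* (ZMod p)ˣ from
    { toFun f := ⟨(f (Multiplicative.ofAdd 1)).toAdd, (f⁻¹ (Multiplicative.ofAdd 1)).toAdd, by
          rw [← toAdd_mulAut_apply, ofAdd_toAdd, MulAut.apply_inv_self, toAdd_ofAdd], by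
          rw [← toAdd_mulAut_apply, ofAdd_toAdd, MulAut.inv_apply_self, toAdd_ofAdd]⟩
      map_one' := by ext; simp
      map_mul' f g := by
        ext
        simp only [MulAut.mul_apply, Units.val_mul]
        rw [← toAdd_mulAut_apply, ofAdd_toAdd] }).comp SemidirectProduct.rightHom
  trans g := g.left.toAdd
  trans_mul g h := by
    change (g.left * g.right h.left).toAdd = g.left.toAdd +
      (g.right (Multiplicative.ofAdd 1)).toAdd * h.left.toAdd
    rw [← toAdd_mulAut_apply, ofAdd_toAdd, toAdd_mul]
  eq_one g h1 h2 := by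
    have h3 : (g.right (Multiplicative.ofAdd 1)).toAdd = 1 := congrArg Units.val h1
    refine SemidirectProduct.ext h2 (MulEquiv.ext fun x => ?_)
    have := toAdd_mulAut_apply g.right x.toAdd
    rw [h3, one_mul, ofAdd_toAdd] at this
    exact this

theorem theorem1p4 (p : ℕ) (hp : p.Prime) (hp5 : 5 < p) :
    (∃ φ : Multiplicative (ZMod (p - 1)) →* MulAut (Multiplicative (ZMod p)),
      Function.Injective φ ∧
      Nonempty (Hol (Multiplicative (ZMod p)) ≃*
        Multiplicative (ZMod p) ⋊[φ] Multiplicative (ZMod (p - 1)))) ∧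
    (eConst (Hol (Multiplicative (ZMod p))) : ℚ) ≤ p + ((p : ℚ) - 3) / 2 ∧
    (fConst (Hol (Multiplicative (ZMod p))) : ℚ) ≤ p + ((p : ℚ) - 3) / 2 := by
  have : Fact p.Prime := ⟨hp⟩
  obtain ⟨k, hk⟩ := hp.odd_of_ne_two (by omega)
  have he := (Hol.affineCoords p).mem_eSet hk hp5
  have hf := eSet_subset_fSet _ he
  have hbound : ∀ m : ℕ, m ≤ 3 * k → (m : ℚ) ≤ p + ((p : ℚ) - 3) / 2 := by
    intro m hm
    have hm' : (m : ℚ) ≤ 3 * k := by exact_mod_cast hm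
    rw [hk]
    push_cast
    linarith
  refine ⟨?_, hbound _ (Nat.sInf_le he), hbound _ (Nat.sInf_le hf)⟩
  have hcyc : IsCyclic (MulAut (Multiplicative (ZMod p))) := by
    have hc : Nat.card (Multiplicative (ZMod p)) = p := Nat.card_zmod p
    have : Fact (Nat.card (Multiplicative (ZMod p))).Prime := ⟨by rwa [hc]⟩
    exact isCyclic_of_surjective (IsCyclic.mulAutMulEquiv (Multiplicative (ZMod p))).symm
      (MulEquiv.surjective _)
  have hcard : Nat.card (MulAut (Multiplicative (ZMod p))) = p - 1 := by
    rw [IsCyclic.card_mulAut, show Nat.card (Multiplicative (ZMod p)) = p from Nat.card_zmod p,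
      Nat.totient_prime hp]
  have e : Multiplicative (ZMod (p - 1)) ≃* MulAut (Multiplicative (ZMod p)) :=
    hcard ▸ zmodCyclicMulEquiv hcyc
  exact ⟨e.toMonoidHom, e.injective, ⟨SemidirectProduct.congr (MulEquiv.refl _) e.symm
    fun g => by ext; simp⟩⟩
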